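/- Let $M$ be a compact connected smooth manifold (Hausdorff, without boundary) of dimension $n \geq 3$, and let $g$ be a smooth Lorentz metric on $M$, i.e. a smooth field of symmetric bilinear forms on the tangent spaces of signature $(-,+,\dots,+)$. Let $H$ be a connected Lie group locally isomorphic to $\mathrm{PSL}(2,\mathbf{R})$, i.e. a connected Lie group whose Lie algebra $\mathfrak{h}$ is isomorphic to $\mathfrak{sl}(2,\mathbf{R})$. Suppose that $H$ acts smoothly and faithfully on $M$ by conformal diffeomorphisms of $g$: for every $h \in H$ there is a smooth function $\varphi_h : M \to \mathbf{R}_{>0}$ with $h^* g = \varphi_h\, g$. Suppose moreover that the action is everywhere locally free: for every $x \in M$, the differential at the identity of the orbit map $H \to M$, $h \mapsto h \cdot x$, is injective on $\mathfrak{h}$ (equivalently, the stabilizer of $x$ is discrete). Then the action is inessential: there is a Lorentz metric $g'$ conformal to $g$, i.e. $g' = \varphi g$ for some smooth function $\varphi : M \to \mathbf{R}_{>0}$, such that $H \subset \mathrm{Isom}(M,g')$, i.e. $h^* g' = g'$ for every $h \in H$. -/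

import Mathlib

open scoped Manifold ContDiff

noncomputable section

section Lorentz

variable {E : Type*} [NormedAddCommGroup E] [NormedSpace ℝ E]
  {HM : Type*} [TopologicalSpace HM]

/-- A smooth Lorentz metric on a smooth manifold `M`: a smooth field of symmetric bilinear forms on
the tangent spaces, each of signature `(-, +, …, +)`. -/
structure LorentzMetric (I : ModelWithCorners ℝ E HM) (M : Type*) [TopologicalSpace M]
    [ChartedSpace HM M] [IsManifold I ∞ M] where
  /-- The bilinear form on the tangent space at `x`. -/
  inner (x : M) : TangentSpace I x →L[ℝ] TangentSpace I x →L[ℝ] ℝ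
  symm (x : M) (v w : TangentSpace I x) : inner x v w = inner x w v
  /-- Signature `(-, +, …, +)`: some vector `t` is negative, and the form is positive definite on
  the orthogonal complement of `t`, which is a hyperplane that does not contain `t`. -/
  signature (x : M) : ∃ t : TangentSpace I x, inner x t t < 0 ∧
    ∀ v : TangentSpace I x, inner x t v = 0 → v ≠ 0 → 0 < inner x v v
  contMDiff : ContMDiff I (I.prod 𝓘(ℝ, E →L[ℝ] E →L[ℝ] ℝ)) ∞
    (fun x ↦ Bundle.TotalSpace.mk' (E →L[ℝ] E →L[ℝ] ℝ) x (inner x))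

namespace LorentzMetric

variable {I : ModelWithCorners ℝ E HM} {M : Type*} [TopologicalSpace M]
  [ChartedSpace HM M] [IsManifold I ∞ M]

/-- `g'` is conformal to `g`: there is a positive smooth function `φ` with `g' = φ g`. -/
def IsConformalTo (g' g : LorentzMetric I M) : Prop :=
  ∃ φ : M → ℝ, ContMDiff I 𝓘(ℝ, ℝ) ∞ φ ∧ (∀ x, 0 < φ x) ∧
    ∀ (x : M) (v w : TangentSpace I x), g'.inner x v w = φ x * g.inner x v w

/-- The diffeomorphism `f` belongs to `Conf(M, g)`: there is a positive smooth function `φ` with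
`f^* g = φ g`. -/
def IsConformal (g : LorentzMetric I M) (f : M ≃ₘ^∞⟮I, I⟯ M) : Prop :=
  ∃ φ : M → ℝ, ContMDiff I 𝓘(ℝ, ℝ) ∞ φ ∧ (∀ x, 0 < φ x) ∧
    ∀ (x : M) (v w : TangentSpace I x),
      g.inner (f x) (mfderiv I I f x v) (mfderiv I I f x w) = φ x * g.inner x v w

/-- The diffeomorphism `f` belongs to `Isom(M, g)`: `f^* g = g`. -/
def IsIsometry (g : LorentzMetric I M) (f : M ≃ₘ^∞⟮I, I⟯ M) : Prop :=
  ∀ (x : M) (v w : TangentSpace I x),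
    g.inner (f x) (mfderiv I I f x v) (mfderiv I I f x w) = g.inner x v w

end LorentzMetric

end Lorentz

section Actions

variable {F : Type*} [NormedAddCommGroup F] [NormedSpace ℝ F]
  {HH : Type*} [TopologicalSpace HH] (J : ModelWithCorners ℝ F HH)
  (H : Type*) [TopologicalSpace H] [ChartedSpace HH H] [Group H]

/-- Over `ℝ`, a smooth Lie group has the regularity under which Mathlib defines the Lie algebra
structure on its tangent space at the identity. -/
instance lieGroupMinSmoothness [LieGroup J ∞ H] : LieGroup J (minSmoothness ℝ 3) H := by
  rw [minSmoothness_of_isRCLikeNormedField]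
  infer_instance

/-- A Lie group is locally isomorphic to `PSL(2, ℝ)` when its Lie algebra is isomorphic to that of
`PSL(2, ℝ)`, which is `sl(2, ℝ)`. -/
def IsLocallyIsomorphicToPSL2R [CompleteSpace F] [LieGroup J ∞ H] : Prop :=
  Nonempty (GroupLieAlgebra J H ≃ₗ⁅ℝ⁆ LieAlgebra.SpecialLinear.sl (Fin 2) ℝ)

variable {E : Type*} [NormedAddCommGroup E] [NormedSpace ℝ E]
  {HM : Type*} [TopologicalSpace HM] (I : ModelWithCorners ℝ E HM)
  (M : Type*) [TopologicalSpace M] [ChartedSpace HM M] [MulAction H M]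

/-- The action of `H` on `M` is locally free at every point: for every `x`, the Lie algebra
`{X | X_x = 0}` of the stabilizer of `x` is zero, where `X_x` is the image of `X` under the
differential at the identity of the orbit map `h ↦ h • x`. -/
def IsEverywhereLocallyFree : Prop :=
  ∀ (x : M) (X : GroupLieAlgebra J H), mfderiv J I (fun h : H ↦ h • x) 1 X = 0 → X = 0

variable {I M} [IsManifold I ∞ M] [ContMDiffSMul J I ∞ H M]

/-- `H` acts on `(M, g)` by conformal diffeomorphisms. -/
def ActsConformally (g : LorentzMetric I M) : Prop :=
  ∀ h : H, g.IsConformal (Diffeomorph.smul J I ∞ h)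

/-- `H` acts on `(M, g)` by isometries. -/
def ActsIsometrically (g : LorentzMetric I M) : Prop :=
  ∀ h : H, g.IsIsometry (Diffeomorph.smul J I ∞ h)

/-- The action of `H` is inessential: it is isometric for some metric conformal to `g`. -/
def ActsInessentially (g : LorentzMetric I M) : Prop :=
  ∃ g' : LorentzMetric I M, g'.IsConformalTo g ∧ ActsIsometrically J H g'

end Actions

end

/-! ### Nilpotency and Lorentz signature -/

section LinearAlgebra
open Matrix

/-! Pull `g` back by the differential of the orbit map to a symmetric form `Q x` on the Lie algebra.
If `h` has conformal factor `r` at `x`, then `Q (h • x)` is `r • Q x` transported by `Ad h⁻¹`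
(`orbitForm_smul`). The Killing form `K` is nondegenerate and `Ad`-invariant, so the endomorphism `A
= K⁻¹ Q` changes only by conjugation and by the factor `r`. Hence `tr A`, `tr A²`, `det A` scale by
`r`, `r²`, `r³`.

These invariants never vanish together: otherwise `A` would be nilpotent, whereas totally null
subspaces of a Lorentz space have dimension at most one (`Matrix.invariants_ne_zero_of_lorentz`).
Suitable even powers therefore add up to a positive smooth function of weight `r ^ 12`. If `f` is
its twelfth root, then `f⁻¹ g` is invariant. -/

theorem Matrix.pow_three_eq_zero_of_invariants_eq_zero {A : Matrix (Fin 3) (Fin 3) ℝ}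
    (h₁ : A.trace = 0) (h₂ : (A * A).trace = 0) (h₃ : A.det = 0) : A * A * A = 0 := by
  -- Cayley-Hamilton, doubled, with the middle coefficient expressed by Newton's identity.
  have key : (2 : ℝ) • (A * A * A) = (2 * A.trace) • (A * A)
      - (A.trace ^ 2 - (A * A).trace) • A + (2 * A.det) • (1 : Matrix (Fin 3) (Fin 3) ℝ) := by
    ext i j
    fin_cases i <;> fin_cases j <;>
      simp [Matrix.mul_apply, Matrix.trace, Fin.sum_univ_three, Matrix.det_fin_three] <;> ring
  rw [h₁, h₂, h₃] at key
  simpa using key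

/-- A nonzero null vector spans the null directions in its orthogonal complement. -/
theorem mem_span_of_null_of_orthogonal {V : Type*} [AddCommGroup V] [Module ℝ V]
    (B : V →ₗ[ℝ] V →ₗ[ℝ] ℝ) (hB : ∀ v w, B v w = B w v) {t : V}
    (ht : ∀ v, B t v = 0 → v ≠ 0 → 0 < B v v) {u w : V} (hu : u ≠ 0) (huu : B u u = 0)
    (huw : B u w = 0) (hww : B w w = 0) : ∃ c : ℝ, w = c • u := by
  have htu : B t u ≠ 0 := fun h ↦ (ht u h hu).ne' huu
  refine ⟨B t w / B t u, ?_⟩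
  by_contra h
  -- The coefficient makes this vector orthogonal to `t`; it is also null, as `u` and `w` span a
  -- totally null space.
  have := ht (w - (B t w / B t u) • u) (by simp [htu]) (sub_ne_zero.2 h)
  simp [huu, huw, hww, hB w u] at this

/-- If all three vanished, `A` would be nilpotent with a kernel vector `k`. Its kernel and range
would both consist of null vectors orthogonal to `k`, hence lie in the line of `k`, against
rank-nullity in dimension three. -/
theorem Matrix.invariants_ne_zero_of_lorentz {V : Type*} [AddCommGroup V] [Module ℝ V]
    (B : V →ₗ[ℝ] V →ₗ[ℝ] ℝ) (hB : ∀ v w, B v w = B w v) {t : V}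
    (ht : ∀ v, B t v = 0 → v ≠ 0 → 0 < B v v) {o : (Fin 3 → ℝ) →ₗ[ℝ] V}
    (ho : Function.Injective o) {K A : Matrix (Fin 3) (Fin 3) ℝ} (hK : K.IsSymm)
    (hA : ∀ v w, B (o v) (o w) = v ⬝ᵥ (K * A) *ᵥ w) :
    A.trace ≠ 0 ∨ (A * A).trace ≠ 0 ∨ A.det ≠ 0 := by
  by_contra! H
  obtain ⟨h₁, h₂, h₃⟩ := H
  have hA3 := pow_three_eq_zero_of_invariants_eq_zero h₁ h₂ h₃
  obtain ⟨k, hk, hAk⟩ := exists_mulVec_eq_zero_iff.2 h₃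
  have hKA : (K * A).IsSymm := by
    ext i j
    have h := hB (o (Pi.single j 1)) (o (Pi.single i 1))
    rw [hA, hA] at h
    simpa using h
  have huw (v) : B (o k) (o v) = 0 := by
    rw [hB, hA, ← mulVec_mulVec, hAk]; simp
  have null (v) (hv : B (o v) (o v) = 0) : v ∈ Submodule.span ℝ {k} := by
    obtain ⟨c, hc⟩ := mem_span_of_null_of_orthogonal B hB ht (u := o k)
      (by rwa [Ne, map_eq_zero_iff _ ho]) (huw k) (huw v) hv
    rw [← map_smul] at hc
    exact Submodule.mem_span_singleton.2 ⟨c, (ho hc).symm⟩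
  have hker : LinearMap.ker A.mulVecLin ≤ Submodule.span ℝ {k} := fun v hv ↦ by
    have hv : A *ᵥ v = 0 := hv
    exact null v (by rw [hA, ← mulVec_mulVec, hv]; simp)
  have hrange : LinearMap.range A.mulVecLin ≤ Submodule.span ℝ {k} := by
    rintro _ ⟨v, rfl⟩
    apply null
    -- The form on the range: symmetry of `K * A` moves `Aᵀ` across `K`, leaving `K * A³`.
    have h : Aᵀ * (K * A * A) = 0 := by
      have : Aᵀ * K = K * A := by
        conv_rhs => rw [← hKA.eq, transpose_mul, hK.eq]
      rw [Matrix.mul_assoc K, ← Matrix.mul_assoc, this, Matrix.mul_assoc, ← Matrix.mul_assoc A,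
        hA3, Matrix.mul_zero]
    rw [hA, mulVecLin_apply, mulVec_mulVec, dotProduct_comm, ← dotProduct_transpose_mulVec,
      mulVec_mulVec, h]
    simp
  have := A.mulVecLin.finrank_range_add_finrank_ker
  have e := finrank_span_singleton (K := ℝ) hk
  have h4 := Submodule.finrank_mono hker
  have h5 := Submodule.finrank_mono hrange
  simp at this
  omega

end LinearAlgebra

/-! ### The Killing form of `sl(2, ℝ)` -/

section Killing

open LieAlgebra

/-- Coordinates on `sl(2, ℝ)`: the matrix `!![a, b; c, -a]` has coordinates `(a, b, c)`. -/
noncomputable def slTwoEquiv : SpecialLinear.sl (Fin 2) ℝ ≃ₗ[ℝ] (Fin 3 → ℝ) where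
  toFun x := ![x.1 0 0, x.1 0 1, x.1 1 0]
  map_add' x y := by ext i; fin_cases i <;> simp
  map_smul' c x := by ext i; fin_cases i <;> simp
  invFun v := ⟨!![v 0, v 1; v 2, -v 0], by simp [SpecialLinear.sl, Matrix.trace_fin_two]⟩
  left_inv x := by
    have h : x.1.trace = 0 := x.2
    rw [Matrix.trace_fin_two] at h
    ext i j
    fin_cases i <;> fin_cases j <;> simp
    linarith
  right_inv v := by ext i; fin_cases i <;> simp

/-- This is the familiar `4 tr (x y)` in coordinates. -/
theorem killingForm_sl_two (x y : SpecialLinear.sl (Fin 2) ℝ) :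
    killingForm ℝ (SpecialLinear.sl (Fin 2) ℝ) x y =
      8 * (x.1 0 0 * y.1 0 0) + 4 * (x.1 0 1 * y.1 1 0 + x.1 1 0 * y.1 0 1) := by
  have hx : x.1 0 0 + x.1 1 1 = 0 := by rw [← Matrix.trace_fin_two]; exact x.2
  have hy : y.1 0 0 + y.1 1 1 = 0 := by rw [← Matrix.trace_fin_two]; exact y.2
  rw [killingForm_apply_apply,
    LinearMap.trace_eq_matrix_trace ℝ (Module.Basis.ofEquivFun slTwoEquiv)]
  simp only [Matrix.trace, Fin.sum_univ_three, Matrix.diag, LinearMap.toMatrix_apply,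
    LinearMap.comp_apply, ad_apply, Module.Basis.ofEquivFun_repr_apply,
    Module.Basis.coe_ofEquivFun]
  simp [slTwoEquiv, -LieSubalgebra.coe_bracket, SpecialLinear.sl_bracket, Matrix.mul_apply,
    Matrix.vecMul, dotProduct]
  rw [show x.1 1 1 = -x.1 0 0 by linarith, show y.1 1 1 = -y.1 0 0 by linarith]
  ring

instance isKilling_sl_two : IsKilling ℝ (SpecialLinear.sl (Fin 2) ℝ) where
  killingCompl_top_eq_bot := by
    rw [eq_bot_iff]
    intro x hx
    rw [LieIdeal.mem_killingCompl] at hx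
    rw [LieSubmodule.mem_bot]
    have h (y) : killingForm ℝ _ y x = 0 := hx y (LieSubmodule.mem_top y)
    apply slTwoEquiv.injective
    have h0 := h (slTwoEquiv.symm ![1, 0, 0])
    have h1 := h (slTwoEquiv.symm ![0, 1, 0])
    have h2 := h (slTwoEquiv.symm ![0, 0, 1])
    simp only [killingForm_sl_two] at h0 h1 h2
    simp [slTwoEquiv] at h0 h1 h2
    ext i
    fin_cases i <;> simp [slTwoEquiv, h0, h1, h2]

end Killing

/-! ### Invariance of the Killing form under group automorphisms -/

section Adjoint

open VectorField

variable {F : Type*} [NormedAddCommGroup F] [NormedSpace ℝ F]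
  {HH : Type*} [TopologicalSpace HH] {J : ModelWithCorners ℝ F HH}
  {H : Type*} [TopologicalSpace H] [ChartedSpace HH H] [Group H]

/-- The differential at the identity of a smooth automorphism of a Lie group. -/
noncomputable def lieDifferential (J : ModelWithCorners ℝ F HH) (c : H ≃* H) :
    GroupLieAlgebra J H →L[ℝ] GroupLieAlgebra J H :=
  mfderiv J J c 1

theorem isInvertible_mfderiv_mulEquiv {c : H ≃* H} (hc : ContMDiff J J ∞ c)
    (hc' : ContMDiff J J ∞ c.symm) (a : H) : (mfderiv J J c a).IsInvertible :=
  let Φ : H ≃ₘ^∞⟮J, J⟯ H := ⟨c.toEquiv, hc, hc'⟩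
  ⟨Φ.mfderivToContinuousLinearEquiv (by simp) a, Φ.mfderivToContinuousLinearEquiv_coe (by simp)⟩

theorem lieDifferential_bijective {c : H ≃* H} (hc : ContMDiff J J ∞ c)
    (hc' : ContMDiff J J ∞ c.symm) : Function.Bijective (lieDifferential J c) :=
  (isInvertible_mfderiv_mulEquiv hc hc' 1).bijective

variable [LieGroup J ∞ H]

/-- Differentiate `c ∘ L_a = L_{c a} ∘ c` at the identity. -/
theorem mfderiv_mulInvariantVectorField {c : H ≃* H} (hc : ContMDiff J J ∞ c)
    (X : GroupLieAlgebra J H) (a : H) :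
    mfderiv J J c a (mulInvariantVectorField X a) =
      mulInvariantVectorField (lieDifferential J c X) (c a) := by
  have hd (a) : MDifferentiableAt J J c a := hc.mdifferentiable (by simp) a
  have hL (b z : H) : MDifferentiableAt J J (fun y ↦ b * y) z :=
    (contMDiff_mul_left (I := J) (n := ∞) (a := b)).mdifferentiable (by simp) z
  have h₁ := mfderiv_comp_apply_of_eq (x := (1 : H)) (hd a) (hL a 1) (mul_one a) X
  have h₂ := mfderiv_comp_apply_of_eq (x := (1 : H)) (hL (c a) 1) (hd 1) (map_one c) X
  have e : (c ∘ fun y ↦ a * y) = (fun y ↦ c a * y) ∘ c := by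
    ext y; simp
  rw [e] at h₁
  exact h₁.symm.trans h₂

theorem mpullback_mulInvariantVectorField_mulEquiv {c : H ≃* H} (hc : ContMDiff J J ∞ c)
    (hc' : ContMDiff J J ∞ c.symm) (X : GroupLieAlgebra J H) :
    mpullback J J c (mulInvariantVectorField (lieDifferential J c X)) =
      mulInvariantVectorField X := by
  ext a
  rw [mpullback_apply, ← mfderiv_mulInvariantVectorField hc]
  exact (isInvertible_mfderiv_mulEquiv hc hc' a).inverse_apply_eq.2 rfl

theorem contMDiff_mulAut_conj (h : H) : ContMDiff J J ∞ (MulAut.conj h) := by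
  have : (MulAut.conj h : H → H) = fun x ↦ h * x * h⁻¹ := by ext; simp
  rw [this]
  exact (contMDiff_const.mul contMDiff_id).mul contMDiff_const

theorem contMDiff_mulAut_conj_symm (h : H) : ContMDiff J J ∞ (MulAut.conj h).symm := by
  have : (MulAut.conj h).symm = MulAut.conj h⁻¹ := by ext; simp
  rw [this]
  exact contMDiff_mulAut_conj _

variable [CompleteSpace F]

theorem lieDifferential_lie {c : H ≃* H} (hc : ContMDiff J J ∞ c)
    (hc' : ContMDiff J J ∞ c.symm) (X Y : GroupLieAlgebra J H) :
    lieDifferential J c ⁅X, Y⁆ = ⁅lieDifferential J c X, lieDifferential J c Y⁆ := by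
  have h := mpullback_mlieBracket (I := J) (I' := J) (f := c) (x₀ := 1) (n := ∞)
    (mdifferentiableAt_mulInvariantVectorField (lieDifferential J c X))
    (mdifferentiableAt_mulInvariantVectorField (lieDifferential J c Y)) hc.contMDiffAt
    (by rw [minSmoothness_of_isRCLikeNormedField]; exact ENat.LEInfty.out)
  rw [mpullback_mulInvariantVectorField_mulEquiv hc hc',
    mpullback_mulInvariantVectorField_mulEquiv hc hc', mpullback_apply,
    (isInvertible_mfderiv_mulEquiv hc hc' 1).inverse_apply_eq] at h
  -- `h` gives the bracket at `c 1`. Both tangent spaces are `F`, so replacing `c 1` by `1` is an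
  -- equality in `F`.
  have h2 := congrArg (fun z : H ↦ (mlieBracket J
    (mulInvariantVectorField (lieDifferential J c X))
    (mulInvariantVectorField (lieDifferential J c Y)) z : F)) (map_one c)
  exact h.symm.trans h2

theorem killingForm_lieDifferential {c : H ≃* H} (hc : ContMDiff J J ∞ c)
    (hc' : ContMDiff J J ∞ c.symm) (X Y : GroupLieAlgebra J H) :
    killingForm ℝ (GroupLieAlgebra J H) (lieDifferential J c X) (lieDifferential J c Y) =
      killingForm ℝ (GroupLieAlgebra J H) X Y :=
  LieAlgebra.killingForm_of_equiv_apply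
    (LieEquiv.ofBijective
      { (lieDifferential J c : GroupLieAlgebra J H →ₗ[ℝ] GroupLieAlgebra J H) with
        map_lie' := lieDifferential_lie hc hc' _ _ } (lieDifferential_bijective hc hc')) X Y

end Adjoint

/-! ### The infinitesimal action -/

section Orbits

open Bundle

variable {F : Type*} [NormedAddCommGroup F] [NormedSpace ℝ F]
  {HH : Type*} [TopologicalSpace HH] {J : ModelWithCorners ℝ F HH}
  {H : Type*} [TopologicalSpace H] [ChartedSpace HH H] [Group H]
  {E : Type*} [NormedAddCommGroup E] [NormedSpace ℝ E]
  {HM : Type*} [TopologicalSpace HM] {I : ModelWithCorners ℝ E HM}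
  {M : Type*} [TopologicalSpace M] [ChartedSpace HM M] [MulAction H M]
  [ContMDiffSMul J I ∞ H M]

/-- The differential at the identity of the orbit map of `x`, that is, `X ↦ X_x`. -/
noncomputable def infinitesimalAction (J : ModelWithCorners ℝ F HH) (H : Type*)
    [TopologicalSpace H] [ChartedSpace HH H] [Group H] [MulAction H M]
    (I : ModelWithCorners ℝ E HM) (x : M) : GroupLieAlgebra J H →L[ℝ] TangentSpace I x :=
  mfderiv J I (fun h : H ↦ h • x) 1

theorem mdifferentiable_smul_const (x : M) : MDifferentiable J I (fun h : H ↦ h • x) :=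
  ((contMDiff_smul (I := J) (I' := I) (n := ∞)).comp
    (contMDiff_id.prodMk contMDiff_const)).mdifferentiable (by simp)

variable [LieGroup J ∞ H]

/-- Differentiate `k • h • x = h • (h⁻¹ * k * h) • x` in `k` at the identity. -/
theorem infinitesimalAction_smul (h : H) (x : M) (X : GroupLieAlgebra J H) :
    infinitesimalAction J H I (h • x) X = mfderiv I I (Diffeomorph.smul J I ∞ h) x
      (infinitesimalAction J H I x (lieDifferential J (MulAut.conj h⁻¹) X)) := by
  have hc : MDifferentiableAt J J (MulAut.conj h⁻¹ : H → H) 1 :=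
    (contMDiff_mulAut_conj h⁻¹).mdifferentiable (by simp) 1
  have h₁ := mfderiv_comp_apply_of_eq (x := (1 : H)) (mdifferentiable_smul_const (I := I) x 1) hc
    (map_one _) X
  have h₂ := mfderiv_comp_apply_of_eq (x := (1 : H)) (y := x)
    ((Diffeomorph.smul J I ∞ h : M ≃ₘ^∞⟮I, I⟯ M).mdifferentiable (by simp) x)
    ((mdifferentiable_smul_const (I := I) x _).comp _ hc) (by simp) X
  rw [h₁] at h₂
  have e : (Diffeomorph.smul J I ∞ h : M ≃ₘ^∞⟮I, I⟯ M) ∘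
      ((fun k : H ↦ k • x) ∘ (MulAut.conj h⁻¹ : H → H)) = fun k : H ↦ k • h • x := by
    ext k
    simp [smul_smul, mul_assoc]
  rw [e] at h₂
  exact h₂

/-- The vector `X_x` is the image of `(X, 0_x)` under the tangent map of the action `H × M → M`,
which is smooth. -/
theorem contMDiff_infinitesimalAction [IsManifold I ∞ M] (X : GroupLieAlgebra J H) :
    ContMDiff I I.tangent ∞
      (fun x : M ↦ (TotalSpace.mk' E x (infinitesimalAction J H I x X) : TangentBundle I M)) := by
  let F₁ : M → TangentBundle J H × TangentBundle I M :=
    fun x ↦ (TotalSpace.mk' F 1 X, TotalSpace.mk' E x 0)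
  have S₁ : ContMDiff I (J.tangent.prod I.tangent) ∞ F₁ :=
    contMDiff_const.prodMk (contMDiff_zeroSection _ _)
  let F₂ : (TangentBundle J H × TangentBundle I M) → TangentBundle (J.prod I) (H × M) :=
    (equivTangentBundleProd J H I M).symm
  have S₂ : ContMDiff (J.tangent.prod I.tangent) (J.prod I).tangent ∞ F₂ :=
    contMDiff_equivTangentBundleProd_symm
  have hsm : ContMDiff (J.prod I) I ∞ (fun p : H × M ↦ p.1 • p.2) := contMDiff_smul
  let F₃ : TangentBundle (J.prod I) (H × M) → TangentBundle I M :=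
    tangentMap (J.prod I) I (fun p : H × M ↦ p.1 • p.2)
  have S₃ : ContMDiff (J.prod I).tangent I.tangent ∞ F₃ :=
    hsm.contMDiff_tangentMap le_rfl
  convert! (S₃.comp S₂).comp S₁ with x
  · simp [F₁, F₂, F₃]
  · simp only [Function.comp_apply, tangentMap, F₃, F₂, F₁]
    rw [mfderiv_prod_eq_add_apply (hsm.mdifferentiableAt (by simp))]
    simp +instances only [infinitesimalAction]
    exact (add_zero _).symm.trans (congrArg _ (map_zero _).symm)

end Orbits

/-! ### A homogeneous conjugation invariant -/

section Weight

open Matrix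

/-- A function of a `3 × 3` matrix that is homogeneous of degree `12`, invariant under conjugation,
nonnegative, and zero exactly at the nilpotent matrices. -/
noncomputable def nilpotencyDefect (A : Matrix (Fin 3) (Fin 3) ℝ) : ℝ :=
  -- The invariants have degrees 1, 2, 3; twelve is the least common degree at which all exponents
  -- are even.
  A.trace ^ 12 + (A * A).trace ^ 6 + A.det ^ 4

theorem nilpotencyDefect_pos {A : Matrix (Fin 3) (Fin 3) ℝ}
    (h : A.trace ≠ 0 ∨ (A * A).trace ≠ 0 ∨ A.det ≠ 0) : 0 < nilpotencyDefect A := by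
  have h₁ : 0 ≤ A.trace ^ 12 := Even.pow_nonneg (by decide) _
  have h₂ : 0 ≤ (A * A).trace ^ 6 := Even.pow_nonneg (by decide) _
  have h₃ : 0 ≤ A.det ^ 4 := Even.pow_nonneg (by decide) _
  unfold nilpotencyDefect
  rcases h with h | h | h
  · have := Even.pow_pos (n := 12) (by decide) h
    positivity
  · have := Even.pow_pos (n := 6) (by decide) h
    positivity
  · have := Even.pow_pos (n := 4) (by decide) h
    positivity

theorem nilpotencyDefect_smul_conj (r : ℝ) {A C P : Matrix (Fin 3) (Fin 3) ℝ} (h : C * P = 1) :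
    nilpotencyDefect (r • (C * A * P)) = r ^ 12 * nilpotencyDefect A := by
  have h' : P * C = 1 := mul_eq_one_comm.1 h
  have hdet : C.det * P.det = 1 := by rw [← det_mul, h, det_one]
  have e₁ : (C * A * P).trace = A.trace := by
    rw [trace_mul_comm, ← Matrix.mul_assoc, h', Matrix.one_mul]
  have e₂ : (C * A * P * (C * A * P)).trace = (A * A).trace := by
    have : C * A * P * (C * A * P) = C * (A * A) * P := by
      calc _ = C * A * (P * C) * A * P := by simp only [Matrix.mul_assoc]
        _ = _ := by rw [h', Matrix.mul_one, Matrix.mul_assoc C A A]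
    rw [this, trace_mul_comm, ← Matrix.mul_assoc, h', Matrix.one_mul]
  have e₃ : (C * A * P).det = A.det := by
    rw [det_mul, det_mul]; linear_combination A.det * hdet
  simp only [nilpotencyDefect, trace_smul, smul_mul, Matrix.mul_smul, det_smul, e₁, e₂, e₃,
    Fintype.card_fin, smul_eq_mul]
  ring

theorem contDiff_nilpotencyDefect_mul (K : Matrix (Fin 3) (Fin 3) ℝ) :
    ContDiff ℝ ∞ (fun Q : Fin 3 → Fin 3 → ℝ ↦ nilpotencyDefect (K * Matrix.of Q)) := by
  simp only [nilpotencyDefect, det_fin_three, Matrix.trace, Matrix.mul_apply, Fin.sum_univ_three,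
    Matrix.diag, Matrix.of_apply]
  fun_prop

end Weight

/-! ### Conformal rescaling by a density -/

section Rescaling

variable {E : Type*} [NormedAddCommGroup E] [NormedSpace ℝ E]
  {HM : Type*} [TopologicalSpace HM] {I : ModelWithCorners ℝ E HM} {M : Type*} [TopologicalSpace M]
  [ChartedSpace HM M] [IsManifold I ∞ M]

namespace LorentzMetric

/-- The metric `φ g`. -/
noncomputable def rescale (g : LorentzMetric I M) (φ : M → ℝ) (hφ : ContMDiff I 𝓘(ℝ, ℝ) ∞ φ)
    (hpos : ∀ x, 0 < φ x) : LorentzMetric I M where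
  inner x := φ x • g.inner x
  symm x v w := by simp [g.symm x v w]
  signature x := by
    obtain ⟨t, ht, htv⟩ := g.signature x
    refine ⟨t, ?_, fun v hv hv0 ↦ ?_⟩
    · simpa using mul_neg_of_pos_of_neg (hpos x) ht
    · have : φ x * g.inner x t v = 0 := hv
      simpa using mul_pos (hpos x) (htv v ((mul_eq_zero.1 this).resolve_left (hpos x).ne') hv0)
  contMDiff := hφ.smul_section g.contMDiff

theorem contMDiff_inner_apply (g : LorentzMetric I M) {X Y : ∀ x : M, TangentSpace I x}
    (hX : ContMDiff I I.tangent ∞ fun x ↦ (Bundle.TotalSpace.mk' E x (X x) : TangentBundle I M))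
    (hY : ContMDiff I I.tangent ∞ fun x ↦ (Bundle.TotalSpace.mk' E x (Y x) : TangentBundle I M)) :
    ContMDiff I 𝓘(ℝ, ℝ) ∞ fun x ↦ g.inner x (X x) (Y x) := by
  intro x
  have h := ContMDiffAt.clm_bundle_apply₂ (F₁ := E) (F₂ := E) (F₃ := ℝ)
    (E₃ := Bundle.Trivial M ℝ) (g.contMDiff x) (hX x) (hY x)
  simp only [Bundle.contMDiffAt_totalSpace] at h
  exact h.2

/-- The criterion for inessentiality: a positive smooth density that the action multiplies by the
conformal factor. -/
theorem actsInessentially_of_density {F : Type*} [NormedAddCommGroup F] [NormedSpace ℝ F]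
    {HH : Type*} [TopologicalSpace HH] {J : ModelWithCorners ℝ F HH}
    {H : Type*} [TopologicalSpace H] [ChartedSpace HH H] [Group H]
    [MulAction H M] [ContMDiffSMul J I ∞ H M] (g : LorentzMetric I M)
    (hconf : ActsConformally J H g) (f : M → ℝ) (hf : ContMDiff I 𝓘(ℝ, ℝ) ∞ f)
    (hpos : ∀ x, 0 < f x)
    (hweight : ∀ (h : H) (x : M) (r : ℝ), 0 < r →
      (∀ v w : TangentSpace I x, g.inner (h • x)
        (mfderiv I I (Diffeomorph.smul J I ∞ h : M ≃ₘ^∞⟮I, I⟯ M) x v)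
        (mfderiv I I (Diffeomorph.smul J I ∞ h : M ≃ₘ^∞⟮I, I⟯ M) x w) = r * g.inner x v w) →
      f (h • x) = r * f x) :
    ActsInessentially J H g := by
  have hinv : ContMDiff I 𝓘(ℝ, ℝ) ∞ fun x ↦ (f x)⁻¹ := fun x ↦
    ((contDiffAt_inv ℝ (hpos x).ne').contMDiffAt).comp x (hf x)
  -- In `f⁻¹ g` the conformal factor of `g` cancels against that of `f`.
  refine ⟨g.rescale (fun x ↦ (f x)⁻¹) hinv fun x ↦ inv_pos.2 (hpos x),
    ⟨_, hinv, fun x ↦ inv_pos.2 (hpos x), fun x v w ↦ by simp [rescale]⟩, fun h x v w ↦ ?_⟩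
  obtain ⟨φ, -, hφ, hg⟩ := hconf h
  have e := hweight h x (φ x) (hφ x) (hg x)
  have hf0 := (hpos x).ne'
  have hφ0 := (hφ x).ne'
  change (f (h • x))⁻¹ * g.inner (h • x) _ _ = (f x)⁻¹ * g.inner x v w
  refine (congrArg ((f (h • x))⁻¹ * ·) (hg x v w)).trans ?_
  simp only [e]
  field_simp

end LorentzMetric

end Rescaling

/-! ### The density of an action and the theorem -/

section Main

open Matrix

variable {F : Type*} [NormedAddCommGroup F] [NormedSpace ℝ F]
  {HH : Type*} [TopologicalSpace HH] {J : ModelWithCorners ℝ F HH}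
  {H : Type*} [TopologicalSpace H] [ChartedSpace HH H] [Group H] [LieGroup J ∞ H]
  {E : Type*} [NormedAddCommGroup E] [NormedSpace ℝ E]
  {HM : Type*} [TopologicalSpace HM] {I : ModelWithCorners ℝ E HM}
  {M : Type*} [TopologicalSpace M] [ChartedSpace HM M] [MulAction H M]
  [IsManifold I ∞ M] [ContMDiffSMul J I ∞ H M]

/-- The metric at `x` as a bilinear form. -/
noncomputable def LorentzMetric.bilin (g : LorentzMetric I M) (x : M) :
    LinearMap.BilinForm ℝ (TangentSpace I x) :=
  LinearMap.mk₂ ℝ (fun v w ↦ g.inner x v w) (by simp) (by simp) (by simp) (by simp)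

/-- The pullback to the Lie algebra of the metric at `x`, by the differential of the orbit map. -/
noncomputable def orbitForm (J : ModelWithCorners ℝ F HH) (H : Type*)
    [TopologicalSpace H] [ChartedSpace HH H] [Group H] [MulAction H M]
    (g : LorentzMetric I M) (x : M) : LinearMap.BilinForm ℝ (GroupLieAlgebra J H) :=
  (g.bilin x).comp (infinitesimalAction J H I x).toLinearMap
    (infinitesimalAction J H I x).toLinearMap

theorem orbitForm_smul (g : LorentzMetric I M) {h : H} {x : M} {r : ℝ}
    (hr : ∀ v w : TangentSpace I x, g.inner (h • x)
      (mfderiv I I (Diffeomorph.smul J I ∞ h : M ≃ₘ^∞⟮I, I⟯ M) x v)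
      (mfderiv I I (Diffeomorph.smul J I ∞ h : M ≃ₘ^∞⟮I, I⟯ M) x w) = r * g.inner x v w) :
    orbitForm J H g (h • x) = r • (orbitForm J H g x).comp
      (lieDifferential J (MulAut.conj h⁻¹)).toLinearMap
      (lieDifferential J (MulAut.conj h⁻¹)).toLinearMap := by
  ext X Y
  change g.inner (h • x) (infinitesimalAction J H I (h • x) X)
    (infinitesimalAction J H I (h • x) Y) = _
  rw [infinitesimalAction_smul, infinitesimalAction_smul]
  exact hr _ _

variable [CompleteSpace F]

/-- The matrix of the metric on the orbit of `x`, relative to the Killing form. -/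
noncomputable def orbitMatrix (b : Module.Basis (Fin 3) ℝ (GroupLieAlgebra J H))
    (g : LorentzMetric I M) (x : M) : Matrix (Fin 3) (Fin 3) ℝ :=
  (LinearMap.BilinForm.toMatrix b (killingForm ℝ (GroupLieAlgebra J H)))⁻¹ *
    LinearMap.BilinForm.toMatrix b (orbitForm J H g x)

theorem isUnit_det_killingForm [LieAlgebra.IsKilling ℝ (GroupLieAlgebra J H)]
    (b : Module.Basis (Fin 3) ℝ (GroupLieAlgebra J H)) :
    IsUnit (LinearMap.BilinForm.toMatrix b (killingForm ℝ (GroupLieAlgebra J H))).det :=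
  isUnit_iff_ne_zero.2 ((LinearMap.BilinForm.nondegenerate_iff_det_ne_zero b).1
    (LieAlgebra.IsKilling.killingForm_nondegenerate _ _))

theorem nilpotencyDefect_orbitMatrix_smul [LieAlgebra.IsKilling ℝ (GroupLieAlgebra J H)]
    (b : Module.Basis (Fin 3) ℝ (GroupLieAlgebra J H)) (g : LorentzMetric I M) {h : H} {x : M}
    {r : ℝ} (hr : ∀ v w : TangentSpace I x, g.inner (h • x)
      (mfderiv I I (Diffeomorph.smul J I ∞ h : M ≃ₘ^∞⟮I, I⟯ M) x v)
      (mfderiv I I (Diffeomorph.smul J I ∞ h : M ≃ₘ^∞⟮I, I⟯ M) x w) = r * g.inner x v w) :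
    nilpotencyDefect (orbitMatrix b g (h • x)) =
      r ^ 12 * nilpotencyDefect (orbitMatrix b g x) := by
  set K := LinearMap.BilinForm.toMatrix b (killingForm ℝ (GroupLieAlgebra J H)) with hK
  set P := LinearMap.toMatrix b b (lieDifferential J (MulAut.conj h⁻¹)).toLinearMap with hP
  have hu : IsUnit K.det := isUnit_det_killingForm b
  -- `Ad`-invariance of the Killing form; it identifies `K⁻¹ * Pᵀ * K` with the inverse of `P`, so
  -- that the change of `K⁻¹ * Q` is a conjugation.
  have hKP : Pᵀ * K * P = K := by
    rw [hP, hK, ← LinearMap.BilinForm.toMatrix_comp]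
    congr 1
    ext X Y
    exact killingForm_lieDifferential (contMDiff_mulAut_conj h⁻¹) (contMDiff_mulAut_conj_symm h⁻¹)
      X Y
  rw [← nilpotencyDefect_smul_conj r (C := K⁻¹ * Pᵀ * K) (P := P)
    (by rw [Matrix.mul_assoc, Matrix.mul_assoc, ← Matrix.mul_assoc Pᵀ, hKP, nonsing_inv_mul _ hu])]
  congr 1
  rw [orbitMatrix, orbitForm_smul g hr, map_smul, LinearMap.BilinForm.toMatrix_comp b b,
    Matrix.mul_smul, orbitMatrix, ← hK, ← hP]
  congr 1
  rw [Matrix.mul_assoc (K⁻¹ * Pᵀ) K, mul_nonsing_inv_cancel_left _ _ hu]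
  simp only [Matrix.mul_assoc]

theorem nilpotencyDefect_orbitMatrix_pos [LieAlgebra.IsKilling ℝ (GroupLieAlgebra J H)]
    (b : Module.Basis (Fin 3) ℝ (GroupLieAlgebra J H)) (g : LorentzMetric I M)
    (hfree : IsEverywhereLocallyFree J H I M) (x : M) :
    0 < nilpotencyDefect (orbitMatrix b g x) := by
  obtain ⟨t, -, ht⟩ := g.signature x
  apply nilpotencyDefect_pos
  -- The negative vector `t` need not be tangent to the orbit, and the form on the orbit may be
  -- degenerate.
  refine Matrix.invariants_ne_zero_of_lorentz (g.bilin x) (g.symm x) (t := t) ht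
    (o := (infinitesimalAction J H I x).toLinearMap ∘ₗ b.equivFun.symm.toLinearMap) ?_
    (K := LinearMap.BilinForm.toMatrix b (killingForm ℝ (GroupLieAlgebra J H))) ?_ ?_
  · rw [LinearMap.coe_comp]
    refine Function.Injective.comp ?_ b.equivFun.symm.injective
    exact (injective_iff_map_eq_zero _).2 (hfree x)
  · ext i j
    simp only [Matrix.transpose_apply, LinearMap.BilinForm.toMatrix_apply]
    exact LieModule.traceForm_comm _ _ _ _ _
  · intro v w
    rw [orbitMatrix, mul_nonsing_inv_cancel_left _ _ (isUnit_det_killingForm b)]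
    change orbitForm J H g x (b.equivFun.symm v) (b.equivFun.symm w) = _
    rw [← LinearMap.BilinForm.dotProduct_toMatrix_mulVec b]

theorem contMDiff_nilpotencyDefect_orbitMatrix
    (b : Module.Basis (Fin 3) ℝ (GroupLieAlgebra J H)) (g : LorentzMetric I M) :
    ContMDiff I 𝓘(ℝ, ℝ) ∞ fun x ↦ nilpotencyDefect (orbitMatrix b g x) := by
  have hQ : ContMDiff I 𝓘(ℝ, Fin 3 → Fin 3 → ℝ) ∞
      fun x i j ↦ orbitForm J H g x (b i) (b j) :=
    contMDiff_pi_space.2 fun i ↦ contMDiff_pi_space.2 fun j ↦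
      g.contMDiff_inner_apply (contMDiff_infinitesimalAction (b i))
        (contMDiff_infinitesimalAction (b j))
  have e (x : M) : LinearMap.BilinForm.toMatrix b (orbitForm J H g x) =
      Matrix.of fun i j ↦ orbitForm J H g x (b i) (b j) := by
    ext i j
    rw [LinearMap.BilinForm.toMatrix_apply, Matrix.of_apply]
  simp only [orbitMatrix, e]
  exact (contDiff_nilpotencyDefect_mul _).contMDiff.comp hQ

/-- An everywhere locally free conformal action of a group with Lie algebra `sl(2, ℝ)` is
inessential. The metric restricted to an orbit is never nilpotent relative to the Killing form, so
that its conjugation invariants provide a positive density that rescales with the conformal factor;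
neither compactness nor connectedness is needed. -/
theorem actsInessentially_of_isEverywhereLocallyFree (hH : IsLocallyIsomorphicToPSL2R J H)
    (g : LorentzMetric I M) (hconf : ActsConformally J H g)
    (hfree : IsEverywhereLocallyFree J H I M) : ActsInessentially J H g := by
  obtain ⟨e⟩ := hH
  have : LieAlgebra.IsKilling ℝ (GroupLieAlgebra J H) := LieAlgebra.isKilling_of_equiv e.symm
  let b : Module.Basis (Fin 3) ℝ (GroupLieAlgebra J H) :=
    Module.Basis.ofEquivFun (e.toLinearEquiv.trans slTwoEquiv)
  have hpos := nilpotencyDefect_orbitMatrix_pos b g hfree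
  refine g.actsInessentially_of_density hconf
    -- The twelfth root turns the weight `r ^ 12` into `r`; it is smooth because the defect is
    -- positive.
    (fun x ↦ nilpotencyDefect (orbitMatrix b g x) ^ (1 / 12 : ℝ))
    (fun x ↦ (Real.contDiffAt_rpow_const_of_ne (hpos x).ne').contMDiffAt.comp x
      (contMDiff_nilpotencyDefect_orbitMatrix b g x))
    (fun x ↦ Real.rpow_pos_of_pos (hpos x) _) fun h x r hr hg ↦ ?_
  simp only [nilpotencyDefect_orbitMatrix_smul b g hg]
  rw [Real.mul_rpow (by positivity) (hpos x).le, ← Real.rpow_natCast, ← Real.rpow_mul hr.le]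
  norm_num

end Main

theorem mainTheorem4 {n m : ℕ} (hn : 3 ≤ n)
    {M : Type*} [TopologicalSpace M] [T2Space M] [CompactSpace M] [ConnectedSpace M]
    [ChartedSpace (EuclideanSpace ℝ (Fin n)) M] [IsManifold (𝓡 n) ∞ M]
    (g : LorentzMetric (𝓡 n) M)
    {H : Type*} [Group H] [TopologicalSpace H] [T2Space H] [ConnectedSpace H]
    [ChartedSpace (EuclideanSpace ℝ (Fin m)) H] [LieGroup (𝓡 m) ∞ H]
    (hH : IsLocallyIsomorphicToPSL2R (𝓡 m) H)
    [MulAction H M] [ContMDiffSMul (𝓡 m) (𝓡 n) ∞ H M] [FaithfulSMul H M]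
    (hconf : ActsConformally (𝓡 m) H g)
    (hfree : IsEverywhereLocallyFree (𝓡 m) H (𝓡 n) M) :
    ActsInessentially (𝓡 m) H g :=
  actsInessentially_of_isEverywhereLocallyFree hH g hconf hfree
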